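/- **Definitions.** For $\lambda>0$ let $\mathrm{Softmax}_\lambda(u)_i=e^{\lambda u_i}/\sum_j e^{\lambda u_j}$ for a vector $u$, applied column by column to a matrix. An $H$-head attention layer with inverse temperature $\lambda$ is a map $$\mathrm{Attn}(Z)=\sum_{h=1}^H W_V^{(h)}Z\,\mathrm{Softmax}_\lambda\big((W_K^{(h)}Z)^\top W_Q^{(h)}Z\big),\qquad W_K^{(h)},W_Q^{(h)}\in\mathbb{R}^{d_h\times d_{\rm in}},\ W_V^{(h)}\in\mathbb{R}^{d_{\rm out}\times d_{\rm in}},$$ and $W_{KQ}^{(h)}:=(W_K^{(h)})^\top W_Q^{(h)}$. For $X\in\mathbb{R}^{d\times n}$ let $P(X)=\begin{bmatrix}X&0_d\\ I_n&0_n\\ 0_{1\times n}&1\end{bmatrix}\in\mathbb{R}^{(d+n+1)\times(n+1)}$ (a zero token and one-hot positional encodings are added), and let $T$ delete the last column. The attention-only Transformer class $\mathcal{T}(H,W,K,C_{KQ},C_V)$ with inverse temperature $\lambda$ consists of the maps $T\circ\mathrm{Attn}^{(K)}\circ\cdots\circ\mathrm{Attn}^{(1)}\circ P$ in which every $\mathrm{Attn}^{(j)}$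 is an $H$-head attention layer on $n+1$ tokens with inverse temperature $\lambda$, all token dimensions $d_j$ (input and output dimensions of the layers) and all head dimensions $d_h$ are at most $W$, and all heads satisfy $\|W_{KQ}\|_F\le C_{KQ}$ and $\|W_V\|_F\le C_V$. **Proposition (Approximation of monomials by attention-only Transformers).** There are absolute constants $A>0$, $q\in\mathbb{N}$ and a real polynomial $p$ such that the following holds. Let $d,n\in\mathbb{N}$ with $dn>2$, let $C_X\ge 1$ and $\epsilon\in(0,1)$, and put $\delta:=C_X/\epsilon$ and $L:=1+\ln\delta$. Then there are $H,W,K\in\mathbb{N}$, $C_{KQ},C_V,\lambda>0$ and a Transformer $f_{\rm mult}:\mathbb{R}^{d\times n}\to\mathbb{R}^{1\times n}$ in $\mathcal{T}(H,W,K,C_{KQ},C_V)$ with inverse temperature $\lambda$ such that, for every $\epsilon_{\rm error}\ge 0$, every $X\in[-C_X,C_X]^{d\times n}$ and every $X'\in\mathbb{R}^{d\times n}$ with $\max_{i,j}|X_{ij}-X'_{ij}|\le\epsilon_{\rm error}$, each of the $n$ entries of the output satisfies $$\Big|f_{\rm mult}(X')_{1,k}-\prod_{j=1}^n\prod_{i=1}^d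 X_{ij}\Big|\le\epsilon+dn\,C_X^{dn-1}\,\epsilon_{\rm error},\qquad k=1,\dots,n.$$ Moreover, with $c:=A\,(dn)^q$, $$H\le c,\quad W\le c,\quad K\le c\,L,\quad C_V\le c\,C_X^{dn},\quad C_{KQ}\le c\,L,\quad \lambda\le c\,\delta\,L^3\,(dn)^{p(\ln\delta)}\,C_X^{p(\ln\delta)} .$$ That is, up to factors polynomial in $d$ and $n$: $H,W=O(1)$, $K=O(\ln\delta)$, $C_V=O(C_X^{dn})$, $C_{KQ}=O(\ln\delta)$ and $\lambda=O\big(\delta\ln^3\delta\,(dn)^{\mathrm{polylog}(\delta)}C_X^{\mathrm{polylog}(\delta)}\big)$. -/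

import Mathlib

open scoped Matrix.Norms.Frobenius

noncomputable section

/-- Softmax with inverse temperature `lam` of a vector `u`. -/
def softmaxVec {m : ℕ} (lam : ℝ) (u : Fin m → ℝ) : Fin m → ℝ :=
  fun i => Real.exp (lam * u i) / ∑ j, Real.exp (lam * u j)

/-- Column-wise softmax of a matrix. -/
def softmaxCols {m k : ℕ} (lam : ℝ) (S : Matrix (Fin m) (Fin k) ℝ) :
    Matrix (Fin m) (Fin k) ℝ :=
  Matrix.of fun i c => softmaxVec lam (fun r => S r c) i

/-- The weights of one attention head with input dimension `din` and output dimension `dout`.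
The hidden dimension `dh` of keys and queries is free for each head. -/
structure AttnHead (din dout : ℕ) where
  dh : ℕ
  WK : Matrix (Fin dh) (Fin din) ℝ
  WQ : Matrix (Fin dh) (Fin din) ℝ
  WV : Matrix (Fin dout) (Fin din) ℝ

/-- The product `W_KQ = W_Kᵀ W_Q`. -/
def AttnHead.WKQ {din dout : ℕ} (a : AttnHead din dout) : Matrix (Fin din) (Fin din) ℝ :=
  a.WK.transpose * a.WQ

/-- The head's contribution `W_V Z Softmax_lam ((W_K Z)ᵀ (W_Q Z))` on `N` tokens. -/
def AttnHead.apply {din dout N : ℕ} (lam : ℝ) (a : AttnHead din dout)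
    (Z : Matrix (Fin din) (Fin N) ℝ) : Matrix (Fin dout) (Fin N) ℝ :=
  a.WV * Z * softmaxCols lam ((a.WK * Z).transpose * (a.WQ * Z))

/-- A multi-head attention layer: the sum of its `H` heads. -/
def attnLayer {H din dout N : ℕ} (lam : ℝ) (heads : Fin H → AttnHead din dout)
    (Z : Matrix (Fin din) (Fin N) ℝ) : Matrix (Fin dout) (Fin N) ℝ :=
  ∑ h, (heads h).apply lam Z

/-- `AttnStack lam H W CKQ CV N K din dout g` says that the map `g`, acting on sequences of `N`
tokens, is a composition of `K` attention layers with `H` heads each and common inverse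
temperature `lam`, that every token dimension and every head dimension is at most `W`, and that
the Frobenius norms of all `W_KQ` and all `W_V` are at most `CKQ` and `CV`. -/
inductive AttnStack (lam : ℝ) (H W : ℕ) (CKQ CV : ℝ) (N : ℕ) :
    (K din dout : ℕ) →
      (Matrix (Fin din) (Fin N) ℝ → Matrix (Fin dout) (Fin N) ℝ) → Prop
  | nil (d : ℕ) (hd : d ≤ W) : AttnStack lam H W CKQ CV N 0 d d id
  | snoc {K din dmid dout : ℕ}
      {g : Matrix (Fin din) (Fin N) ℝ → Matrix (Fin dmid) (Fin N) ℝ}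
      (hg : AttnStack lam H W CKQ CV N K din dmid g)
      (heads : Fin H → AttnHead dmid dout)
      (hout : dout ≤ W)
      (hdh : ∀ h, (heads h).dh ≤ W)
      (hKQ : ∀ h, ‖(heads h).WKQ‖ ≤ CKQ)
      (hV : ∀ h, ‖(heads h).WV‖ ≤ CV) :
      AttnStack lam H W CKQ CV N (K + 1) din dout (fun Z => attnLayer lam heads (g Z))

/-- The preprocessing layer: one zero token is appended to `X`, and below it the one-hot
positional encodings are added, which gives the block matrix `[[X, 0], [I_{n+1}]]`. -/
def preprocess {d n : ℕ} (X : Matrix (Fin d) (Fin n) ℝ) :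
    Matrix (Fin (d + (n + 1))) (Fin (n + 1)) ℝ :=
  Matrix.of fun i k =>
    Fin.addCases (motive := fun _ => ℝ)
      (fun r => Fin.snoc (α := fun _ => ℝ) (X r) 0 k)
      (fun p => if p = k then 1 else 0) i

/-- The truncation layer: the last token is deleted. -/
def truncateLast {m n : ℕ} (Z : Matrix (Fin m) (Fin (n + 1)) ℝ) : Matrix (Fin m) (Fin n) ℝ :=
  Matrix.of fun i j => Z i j.castSucc

/-- The attention-only Transformer class `𝒯(H, W, K, C_KQ, C_V)` with inverse temperature `lam`:
the maps `T ∘ Attn⁽ᴷ⁾ ∘ ⋯ ∘ Attn⁽¹⁾ ∘ P` from `ℝ^{d×n}` to `ℝ^{m×n}`. -/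
def transformerClass (lam : ℝ) (H W K : ℕ) (CKQ CV : ℝ) (d n m : ℕ) :
    Set (Matrix (Fin d) (Fin n) ℝ → Matrix (Fin m) (Fin n) ℝ) :=
  {f | ∃ g : Matrix (Fin (d + (n + 1))) (Fin (n + 1)) ℝ → Matrix (Fin m) (Fin (n + 1)) ℝ,
    AttnStack lam H W CKQ CV (n + 1) K (d + (n + 1)) m g ∧
      f = fun X => truncateLast (g (preprocess X))}

end

/-!
The network works at inverse temperature one and multiplies soft versions of the entries without any
further error.

If `n` of the `n + 1` tokens agree with a vector `u` and the last token is zero, an attention head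
whose keys and queries are given by linear functionals `k` and `q` returns
`attnWeight n (k u * q u)` times a linear image of `u`. Subtracting the head with uniform attention
makes the last token of the output zero again (`Gate.act_tokens`), so that layers can be iterated,
and it acts on `u` by `u ↦ ∑ h, gateFun n (k h u * q h u) • V h u`. Gates of constant score are
exact linear maps; in particular every vector can be doubled by a layer, and in this way large
factors are available in logarithmic depth although the weights are bounded. The first layer
(`sum_loadGate_act`) uses the positional encodings to bring the input exactly into this form.

Three facts about the nonlinearity are used.
* `y * attnWeight n (Λ * y)` is within `n / Λ` of `max y 0` for all real `y`, so that one layer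
  applied to amplified entries clips them to `[-C, C]`, uniformly on the real line
  (`Reaches.clip`, `abs_softClip_sub_clip_le`). Since clipping is `1`-Lipschitz, perturbations of
  the input of any size are harmless.
* Multiplying an accumulator by `gateFun n (η * y)` is a single gate (`Reaches.mulEntries`).
* `gateFun n` vanishes at `0` and is differentiable there, so that `Λ * gateFun n (η * y)` is close
  to `y` for `η` inverse to `Λ` up to a constant (`abs_gateFun_sub_le`). The powers of `Λ` are
  supplied by doubling after all multiplications.

Hence the output is exactly `∏ m, softFactor n C Λ (x m)` (`reaches_prod_softFactor`), with
`softFactor n C Λ` uniformly close to the clipping function, and the error is bounded by comparing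
products factor by factor (`abs_prod_softFactor_sub_le`). It suffices that `Λ = 2 ^ M` with `M` of
order `d * n * (1 + log (C / ε))` (`le_two_pow_of_le`).
-/

/-! ### Attention heads as gates -/

/-- A one-dimensional attention head: keys, queries and values are read off by the linear
functionals `key`, `query` and the matrix `value`. -/
structure Gate (din dout : ℕ) where
  key : Fin din → ℝ
  query : Fin din → ℝ
  value : Matrix (Fin dout) (Fin din) ℝ

namespace Gate

variable {din dout N : ℕ}

/-- The attention head of hidden dimension one with the weights of the gate. -/
def toHead (G : Gate din dout) : AttnHead din dout where
  dh := 1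
  WK := Matrix.of fun _ i => G.key i
  WQ := Matrix.of fun _ i => G.query i
  WV := G.value

/-- The gate with vanishing keys and queries and opposite values; its softmax is uniform. -/
def baseline (G : Gate din dout) : Gate din dout where
  key := 0
  query := 0
  value := -G.value

/-- The joint output of the head of a gate and of the head of its baseline, at inverse temperature
one: the attention weights are replaced by their deviation from the uniform weights. -/
noncomputable def act (G : Gate din dout) (Z : Matrix (Fin din) (Fin N) ℝ) :
    Matrix (Fin dout) (Fin N) ℝ :=
  Matrix.of fun i c => ∑ t, (G.value * Z) i t *
    (softmaxVec 1 (fun r => Matrix.vecMul G.key Z r * Matrix.vecMul G.query Z c) t - (N : ℝ)⁻¹)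

theorem toHead_apply (G : Gate din dout) (Z : Matrix (Fin din) (Fin N) ℝ) (i : Fin dout)
    (c : Fin N) :
    G.toHead.apply 1 Z i c = ∑ t, (G.value * Z) i t *
      softmaxVec 1 (fun r => Matrix.vecMul G.key Z r * Matrix.vecMul G.query Z c) t := by
  have hscore : (G.toHead.WK * Z).transpose * (G.toHead.WQ * Z) =
      Matrix.of fun r c => Matrix.vecMul G.key Z r * Matrix.vecMul G.query Z c := by
    ext r c
    exact Matrix.mul_apply.trans
      (Fin.sum_univ_one fun _ => Matrix.vecMul G.key Z r * Matrix.vecMul G.query Z c)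
  rw [AttnHead.apply, hscore]
  rfl

theorem toHead_apply_add_baseline (G : Gate din dout) (Z : Matrix (Fin din) (Fin N) ℝ) :
    G.toHead.apply 1 Z + G.baseline.toHead.apply 1 Z = G.act Z := by
  ext i c
  rw [Matrix.add_apply, toHead_apply, toHead_apply, ← Finset.sum_add_distrib]
  simp only [act, Matrix.of_apply]
  refine Finset.sum_congr rfl fun t _ => ?_
  simp [baseline, softmaxVec]
  ring

/-- Entrywise bounds on the weights of a gate. -/
structure BoundedBy (B : ℝ) (G : Gate din dout) : Prop where
  key : ∀ i, |G.key i| ≤ 1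
  query : ∀ i, |G.query i| ≤ 1
  value : ∀ i j, |G.value i j| ≤ B

theorem BoundedBy.baseline {B : ℝ} {G : Gate din dout} (h : G.BoundedBy B) :
    G.baseline.BoundedBy B where
  key := by simp [Gate.baseline]
  query := by simp [Gate.baseline]
  value := by simpa [Gate.baseline] using h.value

end Gate

theorem frobenius_norm_le_of_entry_le {m k W : ℕ} {B : ℝ} (M : Matrix (Fin m) (Fin k) ℝ)
    (hm : m ≤ W) (hk : k ≤ W) (hB : 0 ≤ B) (hM : ∀ i j, |M i j| ≤ B) :
    ‖M‖ ≤ (W : ℝ) ^ 2 * B := by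
  rw [Matrix.frobenius_norm_def, ← Real.sqrt_eq_rpow]
  refine Real.sqrt_le_iff.mpr ⟨by positivity, ?_⟩
  have hmk : (m : ℝ) * k ≤ (W : ℝ) ^ 2 := by
    have : m * k ≤ W ^ 2 := by nlinarith
    exact_mod_cast this
  have hW : (m : ℝ) * k ≤ ((m : ℝ) * k) ^ 2 := by
    have : m * k ≤ (m * k) ^ 2 := Nat.le_self_pow (by norm_num) _
    exact_mod_cast this
  calc ∑ i, ∑ j, ‖M i j‖ ^ (2 : ℝ) ≤ ∑ _i : Fin m, ∑ _j : Fin k, B ^ 2 := by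
        refine Finset.sum_le_sum fun i _ => Finset.sum_le_sum fun j _ => ?_
        rw [Real.rpow_two]
        exact pow_le_pow_left₀ (norm_nonneg _) (hM i j) 2
    _ = (m : ℝ) * k * B ^ 2 := by simp [mul_assoc]
    _ ≤ ((W : ℝ) ^ 2) ^ 2 * B ^ 2 := by
        refine mul_le_mul_of_nonneg_right (hW.trans ?_) (by positivity)
        exact pow_le_pow_left₀ (by positivity) hmk 2
    _ = ((W : ℝ) ^ 2 * B) ^ 2 := by ring

/-- Attention layers may be given by fewer than `H` heads: the remaining ones are set to zero. -/
theorem AttnStack.snoc_of_card_le {lam : ℝ} {H W N K din dmid dout : ℕ} {CKQ CV : ℝ} {ι : Type*}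
    [Fintype ι] {g : Matrix (Fin din) (Fin N) ℝ → Matrix (Fin dmid) (Fin N) ℝ}
    (hg : AttnStack lam H W CKQ CV N K din dmid g) (heads : ι → AttnHead dmid dout)
    (hcard : Fintype.card ι ≤ H) (hCKQ : 0 ≤ CKQ) (hCV : 0 ≤ CV) (hout : dout ≤ W)
    (hdh : ∀ h, (heads h).dh ≤ W) (hKQ : ∀ h, ‖(heads h).WKQ‖ ≤ CKQ)
    (hV : ∀ h, ‖(heads h).WV‖ ≤ CV) :
    AttnStack lam H W CKQ CV N (K + 1) din dout
      (fun Z => ∑ h, (heads h).apply lam (g Z)) := by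
  obtain ⟨e⟩ : Nonempty (ι ↪ Fin H) :=
    Function.Embedding.nonempty_of_card_le (by simpa using hcard)
  let zeroHead : AttnHead dmid dout := ⟨0, 0, 0, 0⟩
  let padded : Fin H → AttnHead dmid dout := Function.extend e heads fun _ => zeroHead
  have hin : ∀ i, padded (e i) = heads i := fun i => e.injective.extend_apply _ _ i
  have hnot : ∀ h, (¬ ∃ i, e i = h) → padded h = zeroHead := fun h hh =>
    Function.extend_apply' _ _ _ hh
  have key : ∀ Q : AttnHead dmid dout → Prop, (∀ i, Q (heads i)) → Q zeroHead →
      ∀ h, Q (padded h) := by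
    intro Q h1 h2 h
    by_cases hh : ∃ i, e i = h
    · obtain ⟨i, rfl⟩ := hh
      rw [hin]; exact h1 i
    · rw [hnot h hh]; exact h2
  have hfun : (fun Z => ∑ h, (heads h).apply lam (g Z)) = fun Z => attnLayer lam padded (g Z) := by
    funext Z
    refine Fintype.sum_of_injective e e.injective _ _ (fun h hh => ?_) (fun i => by rw [hin])
    rw [hnot h hh]
    simp [zeroHead, AttnHead.apply]
  rw [hfun]
  refine AttnStack.snoc hg padded hout (key (fun a => a.dh ≤ W) hdh (Nat.zero_le _))
    (key (fun a => ‖a.WKQ‖ ≤ CKQ) hKQ ?_) (key (fun a => ‖a.WV‖ ≤ CV) hV ?_)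
  · simpa [zeroHead, AttnHead.WKQ] using hCKQ
  · simpa [zeroHead] using hCV

/-- A family of gates, each accompanied by its baseline, forms an attention layer. -/
theorem AttnStack.snoc_gates {H W N K din dmid dout : ℕ} {B : ℝ} {ι : Type*}
    [Fintype ι] {g : Matrix (Fin din) (Fin N) ℝ → Matrix (Fin dmid) (Fin N) ℝ}
    (hg : AttnStack 1 H W ((W : ℝ) ^ 2) ((W : ℝ) ^ 2 * B) N K din dmid g)
    (gates : ι → Gate dmid dout) (hcard : 2 * Fintype.card ι ≤ H) (hB : 0 ≤ B) (hW : 1 ≤ W)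
    (hmid : dmid ≤ W) (hout : dout ≤ W) (hb : ∀ h, (gates h).BoundedBy B) :
    AttnStack 1 H W ((W : ℝ) ^ 2) ((W : ℝ) ^ 2 * B) N (K + 1) din dout
      (fun Z => ∑ h, (gates h).act (g Z)) := by
  let all : ι ⊕ ι → Gate dmid dout := Sum.elim gates fun h => (gates h).baseline
  have hall : ∀ h, (all h).BoundedBy B := by
    rintro (h | h)
    · exact hb h
    · exact (hb h).baseline
  have hfun : (fun Z => ∑ h, (gates h).act (g Z)) =
      fun Z => ∑ h, (all h).toHead.apply 1 (g Z) := by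
    funext Z
    rw [Fintype.sum_sum_type, ← Finset.sum_add_distrib]
    exact Finset.sum_congr rfl fun h _ => ((gates h).toHead_apply_add_baseline (g Z)).symm
  rw [hfun]
  refine hg.snoc_of_card_le (fun h => (all h).toHead) ?_ (by positivity) (by positivity) hout
    (fun _ => hW) (fun h => ?_) fun h => ?_
  · rw [Fintype.card_sum]; omega
  · rw [← mul_one ((W : ℝ) ^ 2)]
    refine frobenius_norm_le_of_entry_le _ hmid hmid zero_le_one fun i j => ?_
    have : (all h).toHead.WKQ i j = (all h).key i * (all h).query j :=
      Matrix.mul_apply.trans (Fin.sum_univ_one fun _ => (all h).key i * (all h).query j)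
    rw [this, abs_mul]
    exact mul_le_one₀ ((hall h).key i) (abs_nonneg _) ((hall h).query j)
  · exact frobenius_norm_le_of_entry_le _ hout hmid hB (hall h).value

/-! ### Tokens that agree except for a vanishing last one -/

/-- The sequence of `n + 1` tokens equal to `u`, except for the last one, which is zero. -/
def tokens {r : ℕ} (n : ℕ) (u : Fin r → ℝ) : Matrix (Fin r) (Fin (n + 1)) ℝ :=
  Matrix.of fun i t => if t = Fin.last n then 0 else u i

/-- The attention weight of `n` equal keys of score `z` in the presence of one key of score `0`. -/
noncomputable def attnWeight (n : ℕ) (z : ℝ) : ℝ := n * Real.exp z / (n * Real.exp z + 1)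

/-- The deviation of `attnWeight n z` from its value at `z = 0`. -/
noncomputable def gateFun (n : ℕ) (z : ℝ) : ℝ := attnWeight n z - n / (n + 1)

/-- Key, query and value functionals turn `u` into a gated linear image of `u`; the nonlinearity
`gateFun` vanishes at `0`, so that the last token remains zero. -/
theorem Gate.act_tokens {din dout n : ℕ} (G : Gate din dout) (u : Fin din → ℝ) :
    G.act (tokens n u) =
      tokens n (gateFun n ((G.key ⬝ᵥ u) * (G.query ⬝ᵥ u)) • G.value.mulVec u) := by
  have hne : ∀ t : Fin n, t.castSucc ≠ Fin.last n := fun t => (Fin.castSucc_lt_last t).ne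
  have h1 : ∀ (k : Fin din → ℝ) (t : Fin n),
      Matrix.vecMul k (tokens n u) t.castSucc = k ⬝ᵥ u := by
    intro k t; simp [Matrix.vecMul, tokens, dotProduct, hne]
  have h2 : ∀ (k : Fin din → ℝ), Matrix.vecMul k (tokens n u) (Fin.last n) = 0 := by
    intro k; simp [Matrix.vecMul, tokens, dotProduct]
  have h3 : ∀ i (t : Fin n), (G.value * tokens n u) i t.castSucc = G.value.mulVec u i := by
    intro i t; simp [Matrix.mul_apply, tokens, Matrix.mulVec, dotProduct, hne]
  have h4 : ∀ i, (G.value * tokens n u) i (Fin.last n) = 0 := by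
    intro i; simp [Matrix.mul_apply, tokens]
  ext i c
  simp only [Gate.act, Matrix.of_apply, softmaxVec, Fin.sum_univ_castSucc, h1, h2, h3, h4]
  rcases Fin.eq_castSucc_or_eq_last c with ⟨c, rfl⟩ | rfl
  · simp only [h1, gateFun, attnWeight]
    simp [tokens, hne]
    field_simp
  · simp only [h2]
    simp [tokens]

/-! ### Positional attention: loading the matrix entries -/

section Preprocess

variable {d n : ℕ}

/-- The functional that evaluates to `w t` on the `t`-th token of a preprocessed sequence. -/
def positional (d : ℕ) (w : Fin (n + 1) → ℝ) : Fin (d + (n + 1)) → ℝ := Fin.append 0 w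

/-- The functional that reads the `i`-th data row of a preprocessed sequence. -/
def dataRow (n : ℕ) (i : Fin d) : Fin (d + (n + 1)) → ℝ := Pi.single (Fin.castAdd (n + 1) i) 1

/-- The indicator function of the positions different from the last one. -/
def notLast (n : ℕ) : Fin (n + 1) → ℝ := fun t => if t = Fin.last n then 0 else 1

theorem sum_positional_mul (w : Fin (n + 1) → ℝ) (X : Matrix (Fin d) (Fin n) ℝ)
    (t : Fin (n + 1)) : ∑ r, positional d w r * preprocess X r t = w t := by
  simp [positional, preprocess, Fin.sum_univ_add]

theorem sum_dataRow_mul (i : Fin d) (X : Matrix (Fin d) (Fin n) ℝ) (t : Fin (n + 1)) :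
    ∑ r, dataRow n i r * preprocess X r t = Fin.snoc (α := fun _ => ℝ) (X i) 0 t := by
  simp [dataRow, preprocess, Pi.single_apply, Fin.addCases_left]

/-- The normalization of attention to a single position, without the contribution of the last
token. -/
theorem sum_exp_single (j : Fin n) :
    ∑ r : Fin n, Real.exp (if r = j then 1 else 0) = Real.exp 1 + (n - 1) := by
  have : ∀ r : Fin n, Real.exp (if r = j then 1 else 0) =
      1 + (if r = j then Real.exp 1 - 1 else 0) := by
    intro r; split_ifs <;> simp
  simp [this, Finset.sum_add_distrib]
  ring

/-- Attention to a single position, in deviation from uniform attention, singles out the value at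
that position up to a multiple of the mean. -/
theorem sum_mul_softmax_single (j : Fin n) (f : Fin n → ℝ) :
    ∑ t : Fin n, (Real.exp 1 + n) / (Real.exp 1 - 1) * f t *
      (softmaxVec 1 (fun r : Fin (n + 1) => if r = j.castSucc then (1 : ℝ) else 0) t.castSucc -
        ((n : ℝ) + 1)⁻¹) = f j - (∑ t, f t) / (n + 1) := by
  have he : 0 < Real.exp 1 - 1 := by linarith [Real.exp_one_gt_two]
  have hn : (0 : ℝ) ≤ n := Nat.cast_nonneg n
  have hw : ∀ t : Fin n, (Real.exp 1 + n) / (Real.exp 1 - 1) * f t *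
      (softmaxVec 1 (fun r : Fin (n + 1) => if r = j.castSucc then (1 : ℝ) else 0) t.castSucc -
        ((n : ℝ) + 1)⁻¹) = (if t = j then f t else 0) - f t / (n + 1) := by
    intro t
    have hl : Fin.last n ≠ j.castSucc := (Fin.castSucc_lt_last j).ne'
    simp only [softmaxVec, Fin.sum_univ_castSucc, one_mul, Fin.castSucc_inj, sum_exp_single, hl,
      if_false, Real.exp_zero]
    have : Real.exp 1 + (n - 1) + 1 = Real.exp 1 + n := by ring
    rw [this]
    have h2 : 0 < Real.exp 1 + n := by positivity
    split_ifs
    · field_simp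
      ring
    · rw [Real.exp_zero]
      field_simp
      ring
  simp [hw, Finset.sum_sub_distrib, Finset.sum_div]

theorem gateFun_one (n : ℕ) :
    gateFun n 1 = n * (Real.exp 1 - 1) / ((n * Real.exp 1 + 1) * (n + 1)) := by
  have : 0 < n * Real.exp 1 + 1 := by positivity
  rw [gateFun, attnWeight]
  field_simp
  ring

theorem gateFun_one_pos (hn : 1 ≤ n) : 0 < gateFun n 1 := by
  have he : 0 < Real.exp 1 - 1 := by linarith [Real.exp_one_gt_two]
  have hn' : (0 : ℝ) < n := by exact_mod_cast hn
  rw [gateFun_one]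
  positivity

theorem inv_gateFun_one_le (hn : 1 ≤ n) : (gateFun n 1)⁻¹ ≤ 6 * n := by
  have he := Real.exp_one_gt_two
  have he' : 0 < Real.exp 1 - 1 := by linarith
  have hn' : (1 : ℝ) ≤ n := by exact_mod_cast hn
  rw [gateFun_one, inv_div, div_le_iff₀ (by positivity)]
  calc (n * Real.exp 1 + 1) * ((n : ℝ) + 1) ≤ (n * (Real.exp 1 + 1)) * (2 * n) := by
        gcongr <;> nlinarith
    _ ≤ 6 * n * (n * (Real.exp 1 - 1)) := by
        have : 0 < (n : ℝ) * n := by positivity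
        nlinarith

/-- Uniform attention to all positions but the last one. -/
theorem softmax_notLast_sub (hn : 1 ≤ n) (t : Fin n) :
    softmaxVec 1 (notLast n) t.castSucc - ((n : ℝ) + 1)⁻¹ = gateFun n 1 / n := by
  have hne : ∀ t : Fin n, t.castSucc ≠ Fin.last n := fun t => (Fin.castSucc_lt_last t).ne
  have hn' : (0 : ℝ) < n := by exact_mod_cast hn
  simp [softmaxVec, notLast, Fin.sum_univ_castSucc, hne, gateFun, attnWeight]
  field_simp

/-- The state of the network: the constant `1`, an auxiliary number `s` and a vector `y`. -/
def state {D : ℕ} (s : ℝ) (y : Fin D → ℝ) : Fin (D + 2) → ℝ := Fin.cons 1 (Fin.cons s y)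

/-- The entries of a matrix, as a vector. -/
def entries (X : Matrix (Fin d) (Fin n) ℝ) : Fin (d * n) → ℝ :=
  fun m => X (finProdFinEquiv.symm m).1 (finProdFinEquiv.symm m).2

/-- The gates of the first layer. The gate `some j` attends to position `j`; the gate `none`
attends to all positions but the last one and removes the means that the other gates leave. -/
noncomputable def loadGate (d n : ℕ) (C : ℝ) : Option (Fin n) → Gate (d + (n + 1)) (d * n + 2)
  | none =>
    { key := positional d (notLast n)
      query := positional d (notLast n)
      value := Matrix.of (Fin.cons ((gateFun n 1)⁻¹ • positional d (notLast n))
        (Fin.cons ((C * (gateFun n 1)⁻¹) • positional d (notLast n)) fun m =>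
          (n / ((n + 1) * gateFun n 1)) • dataRow n (finProdFinEquiv.symm m).1)) }
  | some j =>
    { key := positional d (Pi.single j.castSucc 1)
      query := positional d (notLast n)
      value := Matrix.of (Fin.cons 0 (Fin.cons 0 fun m =>
        if (finProdFinEquiv.symm m).2 = j then
          ((Real.exp 1 + n) / (Real.exp 1 - 1)) • dataRow n (finProdFinEquiv.symm m).1
        else 0)) }

theorem abs_positional_le {w : Fin (n + 1) → ℝ} (hw : ∀ t, |w t| ≤ 1) (i) :
    |positional d w i| ≤ 1 := by
  refine Fin.addCases (fun i => ?_) (fun i => ?_) i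
  · simp [positional]
  · simpa [positional] using hw i

theorem abs_single_le {r : ℕ} (j i : Fin r) : |(Pi.single j (1 : ℝ) : Fin r → ℝ) i| ≤ 1 := by
  rw [Pi.single_apply]; split_ifs <;> simp

theorem abs_notLast_le (t : Fin (n + 1)) : |notLast n t| ≤ 1 := by
  rw [notLast]; split_ifs <;> simp

theorem loadGate_boundedBy (hn : 1 ≤ n) {C : ℝ} (hC : 1 ≤ C) (h : Option (Fin n)) :
    (loadGate d n C h).BoundedBy (12 * n * C) := by
  have hg := inv_gateFun_one_le hn
  have hg0 := inv_pos.mpr (gateFun_one_pos hn)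
  have hn' : (1 : ℝ) ≤ n := by exact_mod_cast hn
  have he := Real.exp_one_gt_two
  have he3 := Real.exp_one_lt_three
  have hnC : 12 * (n : ℝ) ≤ 12 * n * C := le_mul_of_one_le_right (by positivity) hC
  have hone : (1 : ℝ) ≤ 12 * n * C := by linarith
  have hmul : ∀ {a b : ℝ}, |a| ≤ 12 * n * C → |b| ≤ 1 → |a * b| ≤ 12 * n * C := by
    intro a b ha hb
    rw [abs_mul]
    calc |a| * |b| ≤ (12 * n * C) * 1 := by gcongr
      _ = _ := mul_one _
  have hpos := abs_positional_le (d := d) (abs_notLast_le (n := n))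
  have hdat : ∀ (i : Fin d) r, |dataRow n i r| ≤ 1 := fun i r => abs_single_le _ _
  cases h with
  | none =>
    refine ⟨hpos, hpos, fun i j => ?_⟩
    refine Fin.cases ?_ (fun i => Fin.cases ?_ (fun m => ?_) i) i
    · refine hmul ?_ (hpos j)
      rw [abs_of_pos hg0]; linarith
    · refine hmul ?_ (hpos j)
      rw [abs_of_pos (by positivity)]
      nlinarith
    · refine hmul ?_ (hdat _ j)
      have : (n : ℝ) / ((n + 1) * gateFun n 1) = n / (n + 1) * (gateFun n 1)⁻¹ := by
        rw [← div_div, div_eq_mul_inv]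
      rw [this, abs_of_pos (by positivity)]
      have : (n : ℝ) / (n + 1) ≤ 1 := by rw [div_le_one (by positivity)]; linarith
      nlinarith
  | some j =>
    refine ⟨abs_positional_le fun t => abs_single_le _ _, hpos, fun i r => ?_⟩
    refine Fin.cases ?_ (fun i => Fin.cases ?_ (fun m => ?_) i) i
    · change |(0 : ℝ)| ≤ _
      rw [abs_zero]; linarith
    · change |(0 : ℝ)| ≤ _
      rw [abs_zero]; linarith
    · simp only [loadGate, Matrix.of_apply, Fin.cons_succ]
      split_ifs
      · refine hmul ?_ (hdat _ r)
        rw [abs_of_pos (div_pos (by positivity) (by linarith)), div_le_iff₀ (by linarith)]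
        nlinarith
      · rw [Pi.zero_apply, abs_zero]; linarith

theorem softmaxVec_const {N : ℕ} (a : ℝ) (t : Fin N) :
    softmaxVec 1 (fun _ : Fin N => a) t = (N : ℝ)⁻¹ := by
  have := Real.exp_ne_zero a
  simp [softmaxVec]
  field_simp

/-- A gate whose key and query depend only on the position has attention weights that do not depend
on the data. -/
theorem act_positional {r : ℕ} (w : Fin (n + 1) → ℝ)
    (V : Matrix (Fin r) (Fin (d + (n + 1))) ℝ) (X : Matrix (Fin d) (Fin n) ℝ) (i : Fin r)
    (c : Fin n) :
    (Gate.mk (positional d w) (positional d (notLast n)) V).act (preprocess X) i c.castSucc =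
      ∑ t, (∑ s, V i s * preprocess X s t) * (softmaxVec 1 w t - ((n : ℝ) + 1)⁻¹) := by
  have hq : notLast n c.castSucc = 1 := by simp [notLast, (Fin.castSucc_lt_last c).ne]
  simp [Gate.act, Matrix.vecMul, dotProduct, sum_positional_mul, hq, Matrix.mul_apply]

theorem act_positional_last {r : ℕ} (w : Fin (n + 1) → ℝ)
    (V : Matrix (Fin r) (Fin (d + (n + 1))) ℝ) (X : Matrix (Fin d) (Fin n) ℝ) (i : Fin r) :
    (Gate.mk (positional d w) (positional d (notLast n)) V).act (preprocess X) i (Fin.last n) =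
      0 := by
  have hq : notLast n (Fin.last n) = 0 := by simp [notLast]
  simp [Gate.act, Matrix.vecMul, dotProduct, sum_positional_mul, hq, softmaxVec_const]

/-- The first layer copies all entries of the matrix to every token but the last one. -/
theorem sum_loadGate_act (hn : 1 ≤ n) (C : ℝ) (X : Matrix (Fin d) (Fin n) ℝ) :
    ∑ h, (loadGate d n C h).act (preprocess X) = tokens n (state C (entries X)) := by
  have hne : ∀ t : Fin n, t.castSucc ≠ Fin.last n := fun t => (Fin.castSucc_lt_last t).ne
  have hn' : (0 : ℝ) < n := by exact_mod_cast hn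
  have hg := (gateFun_one_pos hn).ne'
  have hconst : ∀ a : ℝ, ∑ t : Fin (n + 1),
      (∑ s, (a • positional d (notLast n)) s * preprocess X s t) *
        (softmaxVec 1 (notLast n) t - ((n : ℝ) + 1)⁻¹) = a * gateFun n 1 := by
    intro a
    simp only [Pi.smul_apply, smul_eq_mul, mul_assoc, ← Finset.mul_sum, sum_positional_mul]
    rw [Fin.sum_univ_castSucc]
    simp only [softmax_notLast_sub hn]
    simp only [notLast, hne, if_false, if_true, zero_mul, add_zero, one_mul, Finset.sum_const,
      Finset.card_univ, Fintype.card_fin, nsmul_eq_mul]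
    rw [mul_div_cancel₀ _ hn'.ne']
  ext i c
  rw [Matrix.sum_apply, Fintype.sum_option]
  rcases Fin.eq_castSucc_or_eq_last c with ⟨c, rfl⟩ | rfl
  · simp only [loadGate, act_positional, tokens, Matrix.of_apply, hne, if_false]
    refine Fin.cases ?_ (fun i => Fin.cases ?_ (fun m => ?_) i) i
    · simp only [Fin.cons_zero, hconst]
      simp [state, hg]
    · simp only [Fin.cons_succ, Fin.cons_zero, hconst]
      simp [state, hg]
    · simp only [Fin.cons_succ, state]
      have h0 : ∀ j : Fin n, j ≠ (finProdFinEquiv.symm m).2 →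
          ∑ t : Fin (n + 1), (∑ s, (if (finProdFinEquiv.symm m).2 = j then
            ((Real.exp 1 + n) / (Real.exp 1 - 1)) • dataRow n (finProdFinEquiv.symm m).1
          else 0 : Fin (d + (n + 1)) → ℝ) s * preprocess X s t) *
          (softmaxVec 1 (Pi.single j.castSucc 1) t - ((n : ℝ) + 1)⁻¹) = 0 := by
        intro j hj
        rw [if_neg hj.symm]
        simp
      rw [Fintype.sum_eq_single _ h0, if_pos rfl]
      simp only [Pi.smul_apply, smul_eq_mul, mul_assoc, ← Finset.mul_sum, sum_dataRow_mul]
      have h1 := sum_mul_softmax_single (finProdFinEquiv.symm m).2 (X (finProdFinEquiv.symm m).1)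
      simp only [mul_assoc, ← Finset.mul_sum] at h1
      rw [Fin.sum_univ_castSucc, Fin.sum_univ_castSucc]
      simp only [Fin.snoc_castSucc, Fin.snoc_last, zero_mul, add_zero, softmax_notLast_sub hn]
      have h2 : (Pi.single (finProdFinEquiv.symm m).2.castSucc 1 : Fin (n + 1) → ℝ) =
          fun r => if r = (finProdFinEquiv.symm m).2.castSucc then (1 : ℝ) else 0 := by
        funext r; rw [Pi.single_apply]
      rw [h2, h1, ← Finset.sum_mul]
      simp only [entries]
      field_simp
      ring
  · simp [loadGate, act_positional_last, tokens]

end Preprocess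

/-! ### Gates acting on states -/

section Layers

variable {d n H W : ℕ} {B : ℝ}

/-- `Reaches d n H W B K F` says that `K` attention layers at inverse temperature one can produce
the vector `F X` on every token but the last one, which is zero; `B` bounds the entries of the
value matrices. -/
def Reaches (d n H W : ℕ) (B : ℝ) (K : ℕ) {r : ℕ} (F : Matrix (Fin d) (Fin n) ℝ → Fin r → ℝ) :
    Prop :=
  ∃ g, AttnStack 1 H W ((W : ℝ) ^ 2) ((W : ℝ) ^ 2 * B) (n + 1) K (d + (n + 1)) r g ∧
    ∀ X, g (preprocess X) = tokens n (F X)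

theorem sum_tokens {ι : Type*} [Fintype ι] {r : ℕ} (v : ι → Fin r → ℝ) :
    ∑ h, tokens n (v h) = tokens n (∑ h, v h) := by
  ext i c
  rw [Matrix.sum_apply]
  by_cases hc : c = Fin.last n <;> simp [tokens, hc]

/-- The step that all layers but the first one are instances of. -/
theorem Reaches.gates {K r r' : ℕ} {ι : Type*} [Fintype ι]
    {F : Matrix (Fin d) (Fin n) ℝ → Fin r → ℝ} {F' : Matrix (Fin d) (Fin n) ℝ → Fin r' → ℝ}
    (hF : Reaches d n H W B K F) (G : ι → Gate r r') (hcard : 2 * Fintype.card ι ≤ H)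
    (hB : 0 ≤ B) (hW : 1 ≤ W) (hr : r ≤ W) (hr' : r' ≤ W) (hb : ∀ h, (G h).BoundedBy B)
    (hF' : ∀ X, F' X = ∑ h, gateFun n (((G h).key ⬝ᵥ F X) * ((G h).query ⬝ᵥ F X)) •
      (G h).value.mulVec (F X)) :
    Reaches d n H W B (K + 1) F' := by
  obtain ⟨g, hg, hgX⟩ := hF
  refine ⟨_, hg.snoc_gates G hcard hB hW hr hr' hb, fun X => ?_⟩
  simp only [hgX, Gate.act_tokens, sum_tokens, hF']

variable {D : ℕ}

/-- The functional that reads the constant coordinate of a state. -/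
def coordOne (D : ℕ) : Fin (D + 2) → ℝ := Pi.single 0 1

/-- The functional that reads the auxiliary coordinate of a state. -/
def coordAux (D : ℕ) : Fin (D + 2) → ℝ := Pi.single 1 1

/-- The functional that reads a vector coordinate of a state. -/
def coordVec (m : Fin D) : Fin (D + 2) → ℝ := Pi.single m.succ.succ 1

@[simp] theorem coordOne_dotProduct (s : ℝ) (y : Fin D → ℝ) : coordOne D ⬝ᵥ state s y = 1 := by
  simp [coordOne, state]

@[simp] theorem coordAux_dotProduct (s : ℝ) (y : Fin D → ℝ) : coordAux D ⬝ᵥ state s y = s := by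
  simp only [coordAux, state, single_dotProduct, one_mul]
  rfl

@[simp] theorem coordVec_dotProduct (s : ℝ) (y : Fin D → ℝ) (m : Fin D) :
    coordVec m ⬝ᵥ state s y = y m := by
  simp [coordVec, state]

/-- A gate of constant score: it applies the linear map `V`. -/
noncomputable def linearGate {r : ℕ} (n : ℕ) (V : Matrix (Fin r) (Fin (D + 2)) ℝ) :
    Gate (D + 2) r where
  key := coordOne D
  query := coordOne D
  value := (gateFun n 1)⁻¹ • V

/-- The constant score makes the weight `gateFun n 1`, which is cancelled in the value matrix. -/
theorem linearGate_output (hn : 1 ≤ n) {r : ℕ} (V : Matrix (Fin r) (Fin (D + 2)) ℝ) (s : ℝ)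
    (y : Fin D → ℝ) :
    gateFun n (((linearGate n V).key ⬝ᵥ state s y) * ((linearGate n V).query ⬝ᵥ state s y)) •
      (linearGate n V).value.mulVec (state s y) = V.mulVec (state s y) := by
  simp [linearGate, Matrix.smul_mulVec, smul_smul, (gateFun_one_pos hn).ne']

theorem linearGate_boundedBy (hn : 1 ≤ n) (hB : 12 * (n : ℝ) ≤ B) {r : ℕ}
    {V : Matrix (Fin r) (Fin (D + 2)) ℝ} (hV : ∀ i j, |V i j| ≤ 2) :
    (linearGate n V).BoundedBy B := by
  refine ⟨abs_single_le _, abs_single_le _, fun i j => ?_⟩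
  have h0 := inv_pos.mpr (gateFun_one_pos hn)
  simp only [linearGate, Matrix.smul_apply, smul_eq_mul, abs_mul, abs_of_pos h0]
  calc (gateFun n 1)⁻¹ * |V i j| ≤ 6 * n * 2 :=
        mul_le_mul (inv_gateFun_one_le hn) (hV i j) (abs_nonneg _) (by positivity)
    _ ≤ B := by linarith

theorem reaches_load (hn : 1 ≤ n) {C : ℝ} (hC : 1 ≤ C) (hB : 12 * n * C ≤ B) (hW : 1 ≤ W)
    (hdW : d + (n + 1) ≤ W) (hDW : d * n + 2 ≤ W) (hH : 2 * (n + 1) ≤ H) :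
    Reaches d n H W B 1 fun X => state C (entries X) := by
  refine ⟨_, (AttnStack.nil _ hdW).snoc_gates (loadGate d n C) (by simpa using hH) ?_ hW hdW hDW
    fun h => ?_, fun X => ?_⟩
  · exact le_trans (by positivity) hB
  · have := loadGate_boundedBy (d := d) hn hC h
    exact ⟨this.key, this.query, fun i j => (this.value i j).trans hB⟩
  · exact sum_loadGate_act hn C X

/-- The bounds on the sizes of the parameters under which all layers below exist. -/
structure Admissible (n H W D : ℕ) (B : ℝ) : Prop where
  pos : 1 ≤ n
  heads : 4 * D + 2 ≤ H
  two_le : 2 ≤ D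
  width : D + 2 ≤ W
  bound : 12 * (n : ℝ) ≤ B

theorem Admissible.nonneg (h : Admissible n H W D B) : 0 ≤ B :=
  le_trans (by positivity) h.bound

theorem Reaches.linear {K r : ℕ} (h : Admissible n H W D B)
    {s : Matrix (Fin d) (Fin n) ℝ → ℝ} {y : Matrix (Fin d) (Fin n) ℝ → Fin D → ℝ}
    {F' : Matrix (Fin d) (Fin n) ℝ → Fin r → ℝ}
    (hF : Reaches d n H W B K fun X => state (s X) (y X))
    (V : Matrix (Fin r) (Fin (D + 2)) ℝ) (hr : r ≤ W) (hV : ∀ i j, |V i j| ≤ 2)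
    (hF' : ∀ X, F' X = V.mulVec (state (s X) (y X))) :
    Reaches d n H W B (K + 1) F' := by
  have hh := h.heads
  have := h.two_le
  refine hF.gates (fun _ : Unit => linearGate n V) (by simp; omega) h.nonneg
    (by have := h.width; omega) h.width hr (fun _ => linearGate_boundedBy h.pos h.bound hV)
    fun X => ?_
  rw [Fintype.sum_unique, linearGate_output h.pos, hF']

theorem Reaches.double {K : ℕ} (h : Admissible n H W D B)
    {s : Matrix (Fin d) (Fin n) ℝ → ℝ} {y : Matrix (Fin d) (Fin n) ℝ → Fin D → ℝ}
    (hF : Reaches d n H W B K fun X => state (s X) (y X)) :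
    Reaches d n H W B (K + 1) fun X => state (2 * s X) (fun m => 2 * y X m) := by
  refine hF.linear h (Matrix.diagonal (Fin.cons 1 fun _ => 2)) h.width (fun i j => ?_) fun X => ?_
  · rw [Matrix.diagonal_apply]
    split_ifs
    · refine Fin.cases ?_ (fun i => ?_) i <;> simp
    · simp
  · ext i
    rw [Matrix.mulVec_diagonal]
    refine Fin.cases ?_ (fun i => Fin.cases ?_ (fun m => ?_) i) i <;> simp [state]

theorem Reaches.scale {K : ℕ} (h : Admissible n H W D B)
    {s : Matrix (Fin d) (Fin n) ℝ → ℝ} {y : Matrix (Fin d) (Fin n) ℝ → Fin D → ℝ}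
    (hF : Reaches d n H W B K fun X => state (s X) (y X)) (M : ℕ) :
    Reaches d n H W B (K + M) fun X => state (2 ^ M * s X) (fun m => 2 ^ M * y X m) := by
  induction M with
  | zero => simpa using hF
  | succ M ih =>
    have := ih.double h
    simp only [← mul_assoc, ← pow_succ'] at this
    exact this

theorem Reaches.output {K : ℕ} (h : Admissible n H W D B)
    {s : Matrix (Fin d) (Fin n) ℝ → ℝ} {y : Matrix (Fin d) (Fin n) ℝ → Fin D → ℝ}
    (hF : Reaches d n H W B K fun X => state (s X) (y X)) :
    Reaches d n H W B (K + 1) fun X => (fun _ => s X : Fin 1 → ℝ) := by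
  refine hF.linear h (Matrix.of fun _ => coordAux D) (by have := h.width; omega) (fun i j => ?_)
    fun X => ?_
  · exact (abs_single_le _ _).trans one_le_two
  · ext i
    exact (coordAux_dotProduct _ _).symm

/-- The smoothed clipping to `[-C, C]`: a difference of two ramps, with scores scaled by `Λ`. -/
noncomputable def softClip (n : ℕ) (C Λ x : ℝ) : ℝ :=
  (x + C) * attnWeight n (Λ * (x + C)) - (x - C) * attnWeight n (Λ * (x - C)) - C

/-- `1` for `true` and `-1` for `false`. -/
def boolSign (b : Bool) : ℝ := cond b 1 (-1)

/-- The gates of the clipping layer. The gate `some (m, σ)` multiplies `y m + σ * s` by a weight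
that depends on the same number, where `σ` is the sign encoded by the Boolean. -/
noncomputable def clipGate (n D : ℕ) (Λ : ℝ) : Option (Fin D × Bool) → Gate (D + 2) (D + 2)
  | none => linearGate n (Matrix.of (Fin.cons (coordOne D) (Fin.cons (coordOne D)
      fun _ => ((2 * n / (n + 1) - 1) / Λ) • coordAux D)))
  | some (m, b) =>
    { key := coordVec m + boolSign b • coordAux D
      query := coordOne D
      value := Matrix.vecMulVec ((boolSign b / Λ) • coordVec m)
        (coordVec m + boolSign b • coordAux D) }

theorem succ_succ_ne_one (m : Fin D) : m.succ.succ ≠ 1 := by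
  rw [← Fin.succ_zero_eq_one, Ne, Fin.succ_inj]; exact Fin.succ_ne_zero m

theorem abs_coordVec_add_le (m : Fin D) (b : Bool) (i : Fin (D + 2)) :
    |(coordVec m + boolSign b • coordAux D) i| ≤ 1 := by
  have hm := succ_succ_ne_one m
  by_cases h1 : i = m.succ.succ
  · subst h1; simp [coordVec, coordAux, hm]
  · by_cases h2 : i = 1
    · subst h2; cases b <;> simp [coordVec, coordAux, boolSign, hm.symm]
    · simp [coordVec, coordAux, h1, h2]

theorem clipGate_boundedBy (h : Admissible n H W D B) {Λ : ℝ} (hΛ : 1 ≤ Λ)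
    (i : Option (Fin D × Bool)) : (clipGate n D Λ i).BoundedBy B := by
  have hn : (1 : ℝ) ≤ n := by exact_mod_cast h.pos
  have hB : 1 ≤ B := by linarith [h.bound]
  cases i with
  | none =>
    refine linearGate_boundedBy h.pos h.bound fun i j => ?_
    refine Fin.cases ?_ (fun i => Fin.cases ?_ (fun m => ?_) i) i
    · exact (abs_single_le _ _).trans one_le_two
    · exact (abs_single_le _ _).trans one_le_two
    · simp only [Matrix.of_apply, Fin.cons_succ, Pi.smul_apply, smul_eq_mul, abs_mul, abs_div]
      have h1 : |2 * (n : ℝ) / (n + 1) - 1| ≤ 1 := by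
        rw [abs_le]
        constructor
        · have : 0 ≤ 2 * (n : ℝ) / (n + 1) := by positivity
          linarith
        · have : 2 * (n : ℝ) / (n + 1) ≤ 2 := by rw [div_le_iff₀ (by positivity)]; linarith
          linarith
      have h2 : |2 * (n : ℝ) / (n + 1) - 1| / |Λ| ≤ 1 := by
        rw [abs_of_pos (zero_lt_one.trans_le hΛ)]
        exact div_le_one_of_le₀ (h1.trans hΛ) (by linarith)
      exact (mul_le_one₀ h2 (abs_nonneg _) (abs_single_le _ _)).trans one_le_two
  | some p =>
    obtain ⟨m, b⟩ := p
    refine ⟨abs_coordVec_add_le m b, abs_single_le _, fun i j => ?_⟩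
    simp only [clipGate, Matrix.vecMulVec_apply, abs_mul, Pi.smul_apply, smul_eq_mul]
    have h1 : |boolSign b / Λ| ≤ 1 := by
      rw [abs_div, abs_of_pos (zero_lt_one.trans_le hΛ)]
      refine div_le_one_of_le₀ ?_ (by linarith)
      cases b <;> simpa [boolSign] using hΛ
    exact (mul_le_one₀ (mul_le_one₀ h1 (abs_nonneg _) (abs_single_le _ _)) (abs_nonneg _)
      (abs_coordVec_add_le m b j)).trans hB

/-- The clipping layer, applied to a state amplified by `Λ`, which undoes the amplification. -/
theorem Reaches.clip {K : ℕ} (h : Admissible n H W D B) {C Λ : ℝ} (hΛ : 1 ≤ Λ)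
    {x : Matrix (Fin d) (Fin n) ℝ → Fin D → ℝ}
    (hF : Reaches d n H W B K fun X => state (Λ * C) (fun m => Λ * x X m)) :
    Reaches d n H W B (K + 1) fun X => state 1 (fun m => softClip n C Λ (x X m)) := by
  have hh := h.heads
  have hΛ' : Λ ≠ 0 := by linarith
  refine hF.gates (clipGate n D Λ) (by simp; omega) h.nonneg (by have := h.width; omega)
    h.width h.width (clipGate_boundedBy h hΛ) fun X => ?_
  rw [Fintype.sum_option, Fintype.sum_prod_type]
  simp only [Fintype.sum_bool]
  have hnone : ∀ s y, gateFun n (((clipGate n D Λ none).key ⬝ᵥ state s y) *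
      ((clipGate n D Λ none).query ⬝ᵥ state s y)) • (clipGate n D Λ none).value.mulVec (state s y) =
      state 1 fun _ => ((2 * n / (n + 1) - 1) / Λ) * s := by
    intro s y
    refine (linearGate_output h.pos _ s y).trans ?_
    ext i
    refine Fin.cases ?_ (fun i => Fin.cases ?_ (fun m => ?_) i) i
    · exact coordOne_dotProduct _ _
    · exact coordOne_dotProduct _ _
    · change (((2 * (n : ℝ) / (n + 1) - 1) / Λ) • coordAux D) ⬝ᵥ state s y = _
      rw [smul_dotProduct, coordAux_dotProduct]
      simp [state]
  rw [hnone]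
  simp only [clipGate, Matrix.vecMulVec_mulVec, add_dotProduct, smul_dotProduct,
    coordAux_dotProduct, coordVec_dotProduct, coordOne_dotProduct, mul_one]
  ext i
  rw [Pi.add_apply, Finset.sum_apply]
  refine Fin.cases ?_ (fun i => Fin.cases ?_ (fun m => ?_) i) i
  · simp [state, coordVec]
  · have h0 : ∀ m : Fin D, coordVec m (Fin.succ 0) = 0 := fun m =>
      Pi.single_eq_of_ne (succ_succ_ne_one m).symm _
    simp only [Pi.add_apply, Pi.smul_apply, smul_eq_mul, MulOpposite.smul_eq_mul_unop, h0,
      mul_zero, zero_mul, add_zero, Finset.sum_const_zero]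
    rfl
  · simp [state, coordVec, softClip, Pi.single_apply, Finset.sum_add_distrib]
    simp only [gateFun, boolSign, cond_true, cond_false]
    have h1 : Λ * x X m + 1 * (Λ * C) = Λ * (x X m + C) := by ring
    have h2 : Λ * x X m + -1 * (Λ * C) = Λ * (x X m - C) := by ring
    rw [h1, h2]
    field_simp
    ring

/-- The gates of a multiplication layer: `false` preserves all coordinates but the auxiliary one,
and `true` multiplies the auxiliary coordinate by `gateFun` of the `m`-th entry times `η`. -/
noncomputable def mulGate (n : ℕ) (η : ℝ) (m : Fin D) : Bool → Gate (D + 2) (D + 2)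
  | false => linearGate n (Matrix.diagonal (Fin.cons 1 (Fin.cons 0 fun _ => 1)))
  | true =>
    { key := η • coordVec m
      query := coordOne D
      value := Matrix.vecMulVec (coordAux D) (coordAux D) }

theorem mulGate_boundedBy (h : Admissible n H W D B) {η : ℝ} (hη : |η| ≤ 1) (m : Fin D)
    (b : Bool) : (mulGate n η m b).BoundedBy B := by
  have hn : (1 : ℝ) ≤ n := by exact_mod_cast h.pos
  have hB : 1 ≤ B := by linarith [h.bound]
  cases b with
  | false =>
    refine linearGate_boundedBy h.pos h.bound fun i j => ?_
    rw [Matrix.diagonal_apply]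
    split_ifs
    · refine Fin.cases ?_ (fun i => Fin.cases ?_ (fun m => ?_) i) i <;> simp
    · simp
  | true =>
    refine ⟨fun i => ?_, abs_single_le _, fun i j => ?_⟩
    · simp only [mulGate, Pi.smul_apply, smul_eq_mul, abs_mul]
      exact mul_le_one₀ hη (abs_nonneg _) (abs_single_le _ _)
    · simp only [mulGate, Matrix.vecMulVec_apply, abs_mul]
      exact (mul_le_one₀ (abs_single_le _ _) (abs_nonneg _) (abs_single_le _ _)).trans hB

theorem Reaches.mulEntry {K : ℕ} (h : Admissible n H W D B) {η : ℝ} (hη : |η| ≤ 1) (m : Fin D)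
    {s : Matrix (Fin d) (Fin n) ℝ → ℝ} {y : Matrix (Fin d) (Fin n) ℝ → Fin D → ℝ}
    (hF : Reaches d n H W B K fun X => state (s X) (y X)) :
    Reaches d n H W B (K + 1) fun X => state (gateFun n (η * y X m) * s X) (y X) := by
  have hh := h.heads
  have := h.two_le
  refine hF.gates (mulGate n η m) (by simp; omega) h.nonneg (by have := h.width; omega)
    h.width h.width (mulGate_boundedBy h hη m) fun X => ?_
  rw [Fintype.sum_bool]
  have hlin := linearGate_output (D := D) h.pos
    (Matrix.diagonal (Fin.cons 1 (Fin.cons 0 fun _ => 1))) (s X) (y X)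
  simp only [mulGate, hlin, Matrix.vecMulVec_mulVec, smul_dotProduct,
    coordAux_dotProduct, coordVec_dotProduct, coordOne_dotProduct, mul_one]
  ext i
  rw [Pi.add_apply, Matrix.mulVec_diagonal]
  refine Fin.cases ?_ (fun i => Fin.cases ?_ (fun m' => ?_) i) i
  · simp [state, coordAux]
  · simp [state, coordAux]
  · have h0 : coordAux D m'.succ.succ = 0 := Pi.single_eq_of_ne (succ_succ_ne_one m') _
    simp [state, h0]

theorem Reaches.mulEntries {K : ℕ} (h : Admissible n H W D B) {η : ℝ} (hη : |η| ≤ 1)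
    {y : Matrix (Fin d) (Fin n) ℝ → Fin D → ℝ}
    (hF : Reaches d n H W B K fun X => state 1 (y X)) :
    Reaches d n H W B (K + D) fun X => state (∏ m, gateFun n (η * y X m)) (y X) := by
  suffices hs : ∀ S : Finset (Fin D), Reaches d n H W B (K + S.card)
      fun X => state (∏ m ∈ S, gateFun n (η * y X m)) (y X) by
    simpa using hs Finset.univ
  intro S
  induction S using Finset.induction_on with
  | empty => simpa using hF
  | insert m S hm ih =>
    simpa only [Finset.prod_insert hm, Finset.card_insert_of_notMem hm, ← add_assoc] using
      ih.mulEntry h hη m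

end Layers

/-! ### Error bounds -/

section Analysis

variable {n : ℕ}

theorem abs_mul_attnWeight_sub_max_le (hn : 1 ≤ n) {Λ : ℝ} (hΛ : 0 < Λ) (y : ℝ) :
    |y * attnWeight n (Λ * y) - max y 0| ≤ n / Λ := by
  have hn' : (1 : ℝ) ≤ n := by exact_mod_cast hn
  have hden : 0 < n * Real.exp (Λ * y) + 1 := by positivity
  rcases le_total 0 y with hy | hy
  · rw [max_eq_left hy]
    have : y * attnWeight n (Λ * y) - y = -(y / (n * Real.exp (Λ * y) + 1)) := by
      rw [attnWeight]; field_simp; ring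
    rw [this, abs_neg, abs_of_nonneg (by positivity), div_le_div_iff₀ hden hΛ]
    have h1 := Real.add_one_le_exp (Λ * y)
    have h2 : Real.exp (Λ * y) ≤ n * Real.exp (Λ * y) :=
      le_mul_of_one_le_left (Real.exp_pos _).le hn'
    nlinarith [mul_nonneg hΛ.le hy]
  · rw [max_eq_right hy, sub_zero, attnWeight, abs_mul, abs_of_nonpos hy,
      abs_of_nonneg (by positivity), ← mul_div_assoc, div_le_div_iff₀ hden hΛ]
    have h1 := Real.add_one_le_exp (-(Λ * y))
    have h2 : Real.exp (-(Λ * y)) * Real.exp (Λ * y) = 1 := by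
      rw [← Real.exp_add]; simp
    have h3 : -(Λ * y) * Real.exp (Λ * y) ≤ 1 := by
      rw [← h2]; exact mul_le_mul_of_nonneg_right (by linarith) (Real.exp_pos _).le
    have h4 : 0 < n * Real.exp (Λ * y) := by positivity
    nlinarith

/-- Clipping to `[-C, C]`, as a difference of two ramps. -/
noncomputable def clip (C x : ℝ) : ℝ := max (x + C) 0 - max (x - C) 0 - C

theorem abs_clip_le {C : ℝ} (hC : 0 ≤ C) (x : ℝ) : |clip C x| ≤ C := by
  rw [abs_le, clip]
  rcases max_cases (x + C) 0 with h | h <;> rcases max_cases (x - C) 0 with h' | h' <;>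
    constructor <;> linarith

theorem abs_clip_sub_le {C x x' : ℝ} (hx : x ∈ Set.Icc (-C) C) : |clip C x' - x| ≤ |x - x'| := by
  obtain ⟨h1, h2⟩ := hx
  have h3 := le_abs_self (x - x')
  have h4 := neg_abs_le (x - x')
  rw [abs_le, clip]
  rcases max_cases (x' + C) 0 with h | h <;> rcases max_cases (x' - C) 0 with h' | h' <;>
    constructor <;> linarith

theorem abs_softClip_sub_clip_le (hn : 1 ≤ n) {Λ : ℝ} (hΛ : 0 < Λ) (C x : ℝ) :
    |softClip n C Λ x - clip C x| ≤ 2 * n / Λ := by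
  have h1 := abs_mul_attnWeight_sub_max_le hn hΛ (x + C)
  have h2 := abs_mul_attnWeight_sub_max_le hn hΛ (x - C)
  have h3 : softClip n C Λ x - clip C x =
      ((x + C) * attnWeight n (Λ * (x + C)) - max (x + C) 0) -
        ((x - C) * attnWeight n (Λ * (x - C)) - max (x - C) 0) := by
    rw [softClip, clip]; ring
  rw [h3]
  calc _ ≤ _ := abs_sub _ _
    _ ≤ n / Λ + n / Λ := add_le_add h1 h2
    _ = 2 * n / Λ := by ring

/-- The derivative of `gateFun n` at `0` is `n / (n + 1) ^ 2`, with a remainder bounded uniformly in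
`n`. -/
theorem abs_gateFun_sub_le {z : ℝ} (hz : |z| ≤ 1) :
    |gateFun n z - n / ((n : ℝ) + 1) ^ 2 * z| ≤ 3 * z ^ 2 := by
  have hn : (0 : ℝ) ≤ n := Nat.cast_nonneg n
  have hden : 0 < n * Real.exp z + 1 := by positivity
  have h1 := Real.abs_exp_sub_one_sub_id_le hz
  have h2 := Real.abs_exp_sub_one_le hz
  have h3 : gateFun n z - n / ((n : ℝ) + 1) ^ 2 * z =
      (n / (n + 1)) * (((Real.exp z - 1 - z) - n / (n + 1) * z * (Real.exp z - 1)) /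
        (n * Real.exp z + 1)) := by
    rw [gateFun, attnWeight]
    field_simp
    ring
  have h4 : 0 ≤ (n : ℝ) / (n + 1) := by positivity
  have h5 : (n : ℝ) / (n + 1) ≤ 1 := div_le_one_of_le₀ (by linarith) (by linarith)
  have h6 : |(Real.exp z - 1 - z) - n / (n + 1) * z * (Real.exp z - 1)| ≤ 3 * z ^ 2 := by
    refine (abs_sub _ _).trans ?_
    have : |(n : ℝ) / (n + 1) * z * (Real.exp z - 1)| ≤ 2 * z ^ 2 := by
      rw [abs_mul, abs_mul, abs_of_nonneg h4]
      calc (n : ℝ) / (n + 1) * |z| * |Real.exp z - 1| ≤ 1 * |z| * (2 * |z|) := by gcongr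
        _ = 2 * z ^ 2 := by rw [← sq_abs z]; ring
    linarith
  rw [h3, abs_mul, abs_of_nonneg h4, abs_div, abs_of_pos hden]
  calc (n : ℝ) / (n + 1) * (|(Real.exp z - 1 - z) - n / (n + 1) * z * (Real.exp z - 1)| /
        (n * Real.exp z + 1)) ≤ 1 * (3 * z ^ 2 / 1) := by
        gcongr
        linarith [mul_nonneg hn (Real.exp_pos z).le]
    _ = 3 * z ^ 2 := by ring

/-- The number `η` for which `y ↦ Λ * gateFun n (η * y)` has slope one at `0`. -/
noncomputable def slopeScale (n : ℕ) (Λ : ℝ) : ℝ := ((n : ℝ) + 1) ^ 2 / (n * Λ)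

/-- The factor that an entry `x` contributes to the output: a small multiple of the soft clipping of
`x` is passed through `gateFun` and amplified again. -/
noncomputable def softFactor (n : ℕ) (C Λ x : ℝ) : ℝ :=
  Λ * gateFun n (slopeScale n Λ * softClip n C Λ x)

theorem slopeScale_le (hn : 1 ≤ n) {Λ : ℝ} (hΛ : 0 < Λ) : slopeScale n Λ ≤ 4 * n / Λ := by
  have hn' : (1 : ℝ) ≤ n := by exact_mod_cast hn
  rw [slopeScale, div_le_div_iff₀ (by positivity) hΛ]
  have : ((n : ℝ) + 1) ^ 2 ≤ 4 * n ^ 2 := by nlinarith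
  nlinarith

theorem slopeScale_nonneg {Λ : ℝ} (hΛ : 0 < Λ) : 0 ≤ slopeScale n Λ := by
  rw [slopeScale]; positivity

theorem abs_softFactor_sub_clip_le (hn : 1 ≤ n) {C Λ : ℝ} (hC : 1 ≤ C) (hΛ : 8 * n * C ≤ Λ)
    (x : ℝ) : |softFactor n C Λ x - clip C x| ≤ 194 * n ^ 2 * C ^ 2 / Λ := by
  have hn' : (1 : ℝ) ≤ n := by exact_mod_cast hn
  have hnC : (n : ℝ) ≤ n * C := le_mul_of_one_le_right (by linarith) hC
  have hΛ0 : 0 < Λ := by nlinarith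
  set y := softClip n C Λ x with hy
  set η := slopeScale n Λ with hη
  have hη0 : 0 ≤ η := slopeScale_nonneg hΛ0
  have hη4 : η ≤ 4 * n / Λ := slopeScale_le hn hΛ0
  have h1 : |y - clip C x| ≤ 2 * n / Λ := abs_softClip_sub_clip_le hn hΛ0 C x
  have h2 : 2 * n / Λ ≤ C := by
    rw [div_le_iff₀ hΛ0]; nlinarith
  have h3 : |y| ≤ 2 * C := by
    have := abs_sub_abs_le_abs_sub y (clip C x)
    have := abs_clip_le (zero_le_one.trans hC) x
    linarith
  have h4 : |η * y| ≤ 8 * n * C / Λ := by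
    rw [abs_mul, abs_of_nonneg hη0]
    calc η * |y| ≤ 4 * n / Λ * (2 * C) := by gcongr
      _ = _ := by ring
  have h5 : |η * y| ≤ 1 := h4.trans (div_le_one_of_le₀ hΛ hΛ0.le)
  have h6 := abs_gateFun_sub_le (n := n) h5
  have h7 : softFactor n C Λ x - y = Λ * (gateFun n (η * y) - n / ((n : ℝ) + 1) ^ 2 * (η * y)) := by
    have : Λ * (n / ((n : ℝ) + 1) ^ 2 * (η * y)) = y := by
      rw [hη, slopeScale]; field_simp
    rw [mul_sub, this]; rfl
  have h8 : |softFactor n C Λ x - y| ≤ 192 * n ^ 2 * C ^ 2 / Λ := by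
    rw [h7, abs_mul, abs_of_pos hΛ0]
    calc Λ * |gateFun n (η * y) - n / ((n : ℝ) + 1) ^ 2 * (η * y)| ≤
          Λ * (3 * (8 * n * C / Λ) ^ 2) := by
          gcongr
          refine h6.trans ?_
          rw [← sq_abs]
          gcongr
      _ = 192 * n ^ 2 * C ^ 2 / Λ := by field_simp; ring
  calc |softFactor n C Λ x - clip C x| ≤ |softFactor n C Λ x - y| + |y - clip C x| :=
        abs_sub_le _ _ _
    _ ≤ 192 * n ^ 2 * C ^ 2 / Λ + 2 * n / Λ := add_le_add h8 h1
    _ ≤ 192 * n ^ 2 * C ^ 2 / Λ + 2 * n ^ 2 * C ^ 2 / Λ := by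
        have h9 : (n : ℝ) * 1 ≤ n ^ 2 * C ^ 2 :=
          mul_le_mul (le_self_pow₀ hn' two_ne_zero) (one_le_pow₀ hC) zero_le_one (by positivity)
        refine add_le_add le_rfl (div_le_div_of_nonneg_right ?_ hΛ0.le)
        linarith
    _ = 194 * n ^ 2 * C ^ 2 / Λ := by ring

theorem abs_prod_sub_prod_le {ι : Type*} (s : Finset ι) {a b : ι → ℝ} {R τ : ℝ} (hR : 0 < R)
    (ha : ∀ i ∈ s, |a i| ≤ R) (hb : ∀ i ∈ s, |b i| ≤ R) (hab : ∀ i ∈ s, |a i - b i| ≤ τ) :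
    |∏ i ∈ s, a i - ∏ i ∈ s, b i| ≤ s.card * R ^ (s.card - 1) * τ := by
  classical
  -- The factor `R` avoids the truncated subtraction in the induction.
  suffices h : R * |∏ i ∈ s, a i - ∏ i ∈ s, b i| ≤ s.card * R ^ s.card * τ by
    rcases Nat.eq_zero_or_pos s.card with hs | hs
    · rw [Finset.card_eq_zero.mp hs]; simp
    · refine le_of_mul_le_mul_left (h.trans_eq ?_) hR
      obtain ⟨k, hk⟩ := Nat.exists_eq_add_of_lt hs
      rw [hk]; simp [pow_succ]; ring
  induction s using Finset.induction_on with
  | empty => simp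
  | insert i s hi ih =>
    have ih := ih (fun j hj => ha j (Finset.mem_insert_of_mem hj))
      (fun j hj => hb j (Finset.mem_insert_of_mem hj))
      (fun j hj => hab j (Finset.mem_insert_of_mem hj))
    have hi1 := ha i (Finset.mem_insert_self _ _)
    have hi3 := hab i (Finset.mem_insert_self _ _)
    have hprod : |∏ j ∈ s, b j| ≤ R ^ s.card := by
      rw [Finset.abs_prod]
      exact (Finset.prod_le_prod (fun _ _ => abs_nonneg _)
        fun j hj => hb j (Finset.mem_insert_of_mem hj)).trans_eq (Finset.prod_const R)
    rw [Finset.prod_insert hi, Finset.prod_insert hi, Finset.card_insert_of_notMem hi]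
    have hτ : 0 ≤ τ := (abs_nonneg _).trans hi3
    have h1 : a i * ∏ j ∈ s, a j - b i * ∏ j ∈ s, b j =
        a i * (∏ j ∈ s, a j - ∏ j ∈ s, b j) + (a i - b i) * ∏ j ∈ s, b j := by ring
    rw [h1]
    calc R * |a i * (∏ j ∈ s, a j - ∏ j ∈ s, b j) + (a i - b i) * ∏ j ∈ s, b j|
        ≤ R * (R * |∏ j ∈ s, a j - ∏ j ∈ s, b j| + τ * R ^ s.card) := by
          gcongr
          refine (abs_add_le _ _).trans ?_
          rw [abs_mul, abs_mul]
          gcongr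
      _ ≤ R * (s.card * R ^ s.card * τ + τ * R ^ s.card) := by gcongr
      _ = _ := by push_cast; ring

end Analysis

/-! ### The network -/

section Network

variable {d n H W : ℕ} {B : ℝ}

/-- Loading, amplifying, clipping, multiplying and amplifying again yields the product of the soft
factors exactly: the powers of two that the gates lose are restored by the last amplification. -/
theorem reaches_prod_softFactor (h : Admissible n H W (d * n) B) {C : ℝ} (hC : 1 ≤ C)
    (hB : 12 * n * C ≤ B) (hdW : d + (n + 1) ≤ W) (hnH : 2 * (n + 1) ≤ H) {M : ℕ}
    (hM : slopeScale n (2 ^ M) ≤ 1) :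
    Reaches d n H W B (1 + M + 1 + d * n + d * n * M + 1)
      fun X => (fun _ => ∏ m, softFactor n C (2 ^ M) (entries X m) : Fin 1 → ℝ) := by
  have hη : |slopeScale n (2 ^ M)| ≤ 1 := by
    rwa [abs_of_nonneg (slopeScale_nonneg (by positivity))]
  have h1 := reaches_load h.pos hC hB (by omega) hdW h.width hnH
  have h2 := (((h1.scale h M).clip h (one_le_pow₀ one_le_two)).mulEntries h hη).scale h (d * n * M)
  have h3 := h2.output h
  convert h3 using 3 with X
  simp only [softFactor, Finset.prod_mul_distrib, Finset.prod_const, Finset.card_univ,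
    Fintype.card_fin, ← pow_mul, mul_comm M]

theorem prod_entries (X : Matrix (Fin d) (Fin n) ℝ) :
    ∏ m, entries X m = ∏ j, ∏ i, X i j := by
  simp only [entries]
  rw [finProdFinEquiv.symm.prod_comp (fun p : Fin d × Fin n => X p.1 p.2),
    Fintype.prod_prod_type_right]

theorem abs_prod_softFactor_sub_le (hn : 1 ≤ n) {D : ℕ} (hnD : n ≤ D) {C ε Λ : ℝ} (hC : 1 ≤ C)
    (hε : 0 < ε) (hε1 : ε < 1) (hΛ : 194 * (D : ℝ) ^ 3 * (2 * C) ^ (D + 1) / ε ≤ Λ)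
    {x x' : Fin D → ℝ} {εerr : ℝ} (hx : ∀ m, x m ∈ Set.Icc (-C) C)
    (hxx : ∀ m, |x m - x' m| ≤ εerr) :
    |∏ m, softFactor n C Λ (x' m) - ∏ m, x m| ≤ ε + D * C ^ (D - 1) * εerr := by
  have hn' : (1 : ℝ) ≤ n := by exact_mod_cast hn
  have hnD' : (n : ℝ) ≤ D := by exact_mod_cast hnD
  have hD : (1 : ℝ) ≤ D := hn'.trans hnD'
  obtain ⟨k, rfl⟩ : ∃ k, D = k + 1 := ⟨D - 1, by omega⟩
  set D : ℝ := ((k + 1 : ℕ) : ℝ)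
  have hΛ0 : 0 < Λ := lt_of_lt_of_le (by positivity) hΛ
  have hpow : (1 : ℝ) ≤ (2 * C) ^ k := one_le_pow₀ (by linarith)
  have hmain : 194 * D ^ 3 * ((2 * C) ^ k * (4 * C ^ 2)) ≤ ε * Λ := by
    rw [div_le_iff₀ hε] at hΛ
    calc _ = 194 * D ^ 3 * (2 * C) ^ (k + 1 + 1) := by ring
      _ ≤ _ := by linarith
  -- The error of a single factor.
  have hτ : D * (2 * C) ^ k * (194 * n ^ 2 * C ^ 2 / Λ) ≤ ε := by
    rw [← mul_div_assoc, div_le_iff₀ hΛ0]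
    refine le_trans ?_ hmain
    calc D * (2 * C) ^ k * (194 * n ^ 2 * C ^ 2) ≤ D * (2 * C) ^ k * (194 * D ^ 2 * C ^ 2) := by
          gcongr
      _ = 194 * D ^ 3 * ((2 * C) ^ k * (1 * C ^ 2)) := by ring
      _ ≤ _ := by gcongr; norm_num
  have hτ1 : 194 * n ^ 2 * C ^ 2 / Λ ≤ C := by
    have h1 : 1 ≤ D * (2 * C) ^ k := one_le_mul_of_one_le_of_one_le hD hpow
    have h2 : 0 ≤ 194 * n ^ 2 * C ^ 2 / Λ := by positivity
    nlinarith
  have h8 : 8 * n * C ≤ Λ := by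
    have h1 : ε * Λ ≤ Λ := by nlinarith
    refine le_trans ?_ (hmain.trans h1)
    calc 8 * n * C ≤ 8 * D * C ^ 2 := by
          gcongr
          exact le_self_pow₀ hC two_ne_zero
      _ = 2 * D * (1 * (4 * C ^ 2)) := by ring
      _ ≤ 194 * D ^ 3 * ((2 * C) ^ k * (4 * C ^ 2)) := by
          gcongr
          · norm_num
          · exact le_self_pow₀ hD three_ne_zero
  have hf := fun m => abs_softFactor_sub_clip_le hn hC h8 (x' m)
  have hc := fun m => abs_clip_le (zero_le_one.trans hC) (x' m)
  -- The bound `2 * C` on the factors is affordable only here, where `εerr` does not occur.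
  have h1 : |∏ m, softFactor n C Λ (x' m) - ∏ m, clip C (x' m)| ≤ ε := by
    have := abs_prod_sub_prod_le Finset.univ (R := 2 * C) (by linarith)
      (a := fun m => softFactor n C Λ (x' m)) (b := fun m => clip C (x' m))
      (fun m _ => by
        have := abs_sub_abs_le_abs_sub (softFactor n C Λ (x' m)) (clip C (x' m))
        linarith [hf m, hc m])
      (fun m _ => by linarith [hc m]) (fun m _ => hf m)
    rw [Finset.card_univ, Fintype.card_fin, Nat.add_sub_cancel] at this
    exact this.trans hτ
  have h2 : |∏ m, clip C (x' m) - ∏ m, x m| ≤ D * C ^ k * εerr := by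
    have := abs_prod_sub_prod_le Finset.univ (R := C) (by linarith)
      (a := fun m => clip C (x' m)) (b := x) (fun m _ => hc m)
      (fun m _ => abs_le.mpr (hx m)) (fun m _ => (abs_clip_sub_le (hx m)).trans (hxx m))
    rwa [Finset.card_univ, Fintype.card_fin, Nat.add_sub_cancel] at this
  rw [Nat.add_sub_cancel]
  exact (abs_sub_le _ _ _).trans (add_le_add h1 h2)

/-- A number of doublings of order `D * (1 + log (C / ε))` reaches the required amplification. -/
theorem le_two_pow_of_le {D M : ℕ} (hD : 3 ≤ D) {C ε : ℝ} (hC : 1 ≤ C) (hε : 0 < ε) (hε1 : ε < 1)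
    (hM : 20 * D * (1 + Real.log (C / ε)) ≤ M) :
    194 * (D : ℝ) ^ 3 * (2 * C) ^ (D + 1) / ε ≤ 2 ^ M := by
  have hδC : C ≤ C / ε := by rw [le_div_iff₀ hε]; nlinarith
  have hδε : 1 / ε ≤ C / ε := by gcongr
  have hδ : 1 ≤ C / ε := hC.trans hδC
  set δ := C / ε
  have hD' : (3 : ℝ) ≤ D := by exact_mod_cast hD
  have hlog : 0 ≤ Real.log δ := Real.log_nonneg hδ
  have hexp : Real.exp (10 * D * (1 + Real.log δ)) ≤ 2 ^ M := by
    have h2 : (2 : ℝ) ^ M = Real.exp (M * Real.log 2) := by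
      rw [Real.exp_nat_mul, Real.exp_log two_pos]
    rw [h2, Real.exp_le_exp]
    have := Real.log_two_gt_d9
    have h0 : 0 ≤ D * (1 + Real.log δ) := by positivity
    nlinarith
  have hexp2 : Real.exp (10 * D * (1 + Real.log δ)) = Real.exp 1 ^ (10 * D) * δ ^ (10 * D) := by
    rw [← mul_pow, ← Real.exp_log (zero_lt_one.trans_le hδ), ← Real.exp_add, ← Real.exp_nat_mul,
      Real.log_exp]
    push_cast; ring_nf
  rw [hexp2] at hexp
  refine le_trans ?_ hexp
  have hDpow : (D : ℝ) ≤ 2 ^ D := by exact_mod_cast Nat.lt_two_pow_self.le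
  calc 194 * (D : ℝ) ^ 3 * (2 * C) ^ (D + 1) / ε
      = 388 * (D : ℝ) ^ 3 * 2 ^ D * (C ^ (D + 1) * (1 / ε)) := by
        rw [mul_pow, pow_succ (2 : ℝ)]; ring
    _ ≤ 2 ^ (3 * D) * (2 ^ D) ^ 3 * 2 ^ D * (δ ^ (D + 1) * δ) := by
        gcongr
        calc (388 : ℝ) ≤ 2 ^ (3 * 3) := by norm_num
          _ ≤ 2 ^ (3 * D) := pow_le_pow_right₀ one_le_two (by omega)
    _ = 2 ^ (7 * D) * δ ^ (D + 2) := by ring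
    _ ≤ Real.exp 1 ^ (10 * D) * δ ^ (10 * D) := by
        have he := Real.exp_one_gt_two
        have h1 : (2 : ℝ) ^ (7 * D) ≤ Real.exp 1 ^ (10 * D) :=
          (pow_le_pow_right₀ one_le_two (by omega)).trans (pow_le_pow_left₀ two_pos.le he.le _)
        gcongr
        omega

/-- The numbers of heads and layers, the width and the norms of the network, in terms of the number
`D` of factors. -/
theorem network_size_le {D M : ℕ} {C L : ℝ} (hnD : n ≤ D) (hD : 3 ≤ D) (hC : 1 ≤ C)
    (hL : 1 ≤ L) (hM : (M : ℝ) ≤ 21 * D * L) :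
    ((4 * D + 2 : ℕ) : ℝ) ≤ 1000 * D ^ 3 ∧ ((3 * D : ℕ) : ℝ) ≤ 1000 * D ^ 3 ∧
      ((1 + M + 1 + D + D * M + 1 : ℕ) : ℝ) ≤ 1000 * D ^ 3 * L ∧
      ((3 * D : ℕ) : ℝ) ^ 2 * (12 * n * C) ≤ 1000 * D ^ 3 * C ^ D ∧
      ((3 * D : ℕ) : ℝ) ^ 2 ≤ 1000 * D ^ 3 * L := by
  have hnD' : (n : ℝ) ≤ D := by exact_mod_cast hnD
  have hD' : (3 : ℝ) ≤ D := by exact_mod_cast hD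
  have h13 : (D : ℝ) ≤ D ^ 3 := le_self_pow₀ (by linarith) three_ne_zero
  have h23 : (D : ℝ) ^ 2 ≤ D ^ 3 := pow_le_pow_right₀ (by linarith) (by norm_num)
  have h12 : (D : ℝ) ≤ D ^ 2 := le_self_pow₀ (by linarith) two_ne_zero
  have hLle : (D : ℝ) ^ 3 ≤ D ^ 3 * L := le_mul_of_one_le_right (by positivity) hL
  push_cast
  refine ⟨by linarith, by linarith, ?_, ?_, ?_⟩
  · have h1 : (D + 1) * (M : ℝ) ≤ (2 * D) * (21 * D * L) := by gcongr; linarith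
    have h2 : (D : ℝ) ^ 2 * L ≤ D ^ 3 * L := by gcongr
    linarith
  · have hCD : C ≤ C ^ D := le_self_pow₀ hC (by omega)
    calc (3 * (D : ℝ)) ^ 2 * (12 * n * C) ≤ (3 * (D : ℝ)) ^ 2 * (12 * D * C ^ D) := by gcongr
      _ = 108 * (D ^ 3 * C ^ D) := by ring
      _ ≤ 1000 * (D ^ 3 * C ^ D) := by gcongr; norm_num
      _ = _ := by ring
  · linarith

end Network

theorem mainTheorem4 :
    ∃ (A : ℝ) (q : ℕ) (P : Polynomial ℝ),
      ∀ (d n : ℕ), 2 < d * n →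
      ∀ (CX : ℝ), 1 ≤ CX →
      ∀ (ε : ℝ), 0 < ε → ε < 1 →
      ∃ (H W K : ℕ) (CKQ CV lam : ℝ),
        0 < CKQ ∧ 0 < CV ∧ 0 < lam ∧
        (∃ f ∈ transformerClass lam H W K CKQ CV d n 1,
          ∀ (εerr : ℝ) (X X' : Matrix (Fin d) (Fin n) ℝ),
            (∀ i j, X i j ∈ Set.Icc (-CX) CX) →
            (∀ i j, |X i j - X' i j| ≤ εerr) →
            ∀ k : Fin n,
              |f X' 0 k - ∏ j, ∏ i, X i j| ≤
                ε + ((d * n : ℕ) : ℝ) * CX ^ (d * n - 1) * εerr) ∧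
        (H : ℝ) ≤ A * ((d * n : ℕ) : ℝ) ^ q ∧
        (W : ℝ) ≤ A * ((d * n : ℕ) : ℝ) ^ q ∧
        (K : ℝ) ≤ A * ((d * n : ℕ) : ℝ) ^ q * (1 + Real.log (CX / ε)) ∧
        CV ≤ A * ((d * n : ℕ) : ℝ) ^ q * CX ^ (d * n) ∧
        CKQ ≤ A * ((d * n : ℕ) : ℝ) ^ q * (1 + Real.log (CX / ε)) ∧
        lam ≤ A * ((d * n : ℕ) : ℝ) ^ q *
          ((CX / ε) * (1 + Real.log (CX / ε)) ^ 3 *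
            ((d * n : ℕ) : ℝ) ^ (P.eval (Real.log (CX / ε))) *
            CX ^ (P.eval (Real.log (CX / ε)))) := by
  refine ⟨1000, 3, 0, fun d n hdn C hC ε hε hε1 => ?_⟩
  have hd1 : 1 ≤ d := Nat.pos_of_ne_zero (by rintro rfl; omega)
  have hn1 : 1 ≤ n := Nat.pos_of_ne_zero (by rintro rfl; omega)
  have hnD : n ≤ d * n := Nat.le_mul_of_pos_left n hd1
  have hdD : d ≤ d * n := Nat.le_mul_of_pos_right d hn1
  have hδ : 1 ≤ C / ε := by rw [le_div_iff₀ hε]; linarith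
  have hlog : 0 ≤ Real.log (C / ε) := Real.log_nonneg hδ
  have hnpos : (0 : ℝ) < n := by exact_mod_cast hn1
  have hnD' : (n : ℝ) ≤ (d * n : ℕ) := by exact_mod_cast hnD
  have h3 : (3 : ℝ) ≤ (d * n : ℕ) := by exact_mod_cast hdn
  set L := 1 + Real.log (C / ε) with hL
  have hL1 : 1 ≤ L := by linarith
  set M := ⌈20 * ((d * n : ℕ) : ℝ) * L⌉₊ with hMdef
  have hM : 194 * ((d * n : ℕ) : ℝ) ^ 3 * (2 * C) ^ (d * n + 1) / ε ≤ 2 ^ M :=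
    le_two_pow_of_le hdn hC hε hε1 (Nat.le_ceil _)
  have hMle : (M : ℝ) ≤ 21 * (d * n : ℕ) * L := by
    have := (Nat.ceil_lt_add_one (a := 20 * ((d * n : ℕ) : ℝ) * L) (by positivity)).le
    nlinarith
  have hadm : Admissible n (4 * (d * n) + 2) (3 * (d * n)) (d * n) (12 * n * C) :=
    ⟨hn1, le_rfl, by omega, by omega, le_mul_of_one_le_right (by positivity) hC⟩
  have hslope : slopeScale n (2 ^ M) ≤ 1 := by
    refine (slopeScale_le hn1 (by positivity)).trans (div_le_one_of_le₀ (le_trans ?_ hM)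
      (by positivity))
    have h1 : (1 : ℝ) ≤ (2 * C) ^ (d * n + 1) := one_le_pow₀ (by linarith)
    have h2 : ((d * n : ℕ) : ℝ) ≤ ((d * n : ℕ) : ℝ) ^ 3 := le_self_pow₀ (by linarith) three_ne_zero
    rw [le_div_iff₀ hε]
    nlinarith
  obtain ⟨g, hg, hgX⟩ := reaches_prod_softFactor hadm hC le_rfl (by omega) (by omega) hslope
  obtain ⟨hH, hW, hK, hCV, hCKQ⟩ := network_size_le hnD hdn hC hL1 hMle
  have hWpos : (0 : ℝ) < (3 * (d * n) : ℕ) := by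
    have : 0 < 3 * (d * n) := by omega
    exact_mod_cast this
  refine ⟨_, _, _, _, _, 1, by positivity, by positivity, one_pos, ⟨_, ⟨g, hg, rfl⟩, ?_⟩,
    hH, hW, hK, hCV, hCKQ, ?_⟩
  · intro εerr X X' hX hXX' k
    have hk : truncateLast (g (preprocess X')) 0 k =
        ∏ m, softFactor n C (2 ^ M) (entries X' m) := by
      simp [truncateLast, hgX, tokens]
    rw [hk, ← prod_entries]
    exact abs_prod_softFactor_sub_le hn1 hnD hC hε hε1 hM (fun m => hX _ _) fun m => hXX' _ _
  · rw [Polynomial.eval_zero, Real.rpow_zero, Real.rpow_zero, mul_one, mul_one]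
    have h1 : (1 : ℝ) ≤ 1000 * ((d * n : ℕ) : ℝ) ^ 3 := by
      have := one_le_pow₀ (n := 3) (by linarith : (1 : ℝ) ≤ (d * n : ℕ))
      linarith
    exact one_le_mul_of_one_le_of_one_le h1
      (one_le_mul_of_one_le_of_one_le hδ (one_le_pow₀ hL1))
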